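/- **Setting.** Let $C$ be a set of colors. An *arena* $\mathcal A=(S_1,S_2,E)$ consists of a finite set of states $S=S_1\uplus S_2$ (those of player 1 and those of player 2) and a finite set of edges $E\subseteq S\times C\times S$ such that every state has an outgoing edge. Histories (finite sequences of consecutive edges from an initial state $s$, including the empty one at $s$) and plays (infinite ones) are defined as usual. A *strategy* of player $i$ maps each history ending in $S_i$ to an edge leaving its last state. A *preference relation* $\sqsubseteq$ is a total preorder on $C^\omega$, with inverse $\sqsubseteq^{-1}$; write $x\sqsubset y$ for $\neg(y\sqsubseteq x)$. For $X,Y\subseteq C^\omega$ write $X\sqsubseteq Y$ if $\forall x\in X\ \exists y\in Y:\ x\sqsubseteq y$, and $X\sqsubset Y$ if $\exists y\in Y\ \forall x\in X:\ x\sqsubset y$. In the game $(\mathcal A,\sqsubseteq)$, player 1 wants the color sequence of the play to be as large as possible for $\sqsubseteq$, and player 2 as small as possible. A *memory skeleton* $\mathcal M=(M,m_{\mathrm{init}},\alpha_{\mathrm{upd}})$ consists of a finite set $M$, a state $m_{\mathrm{init}}\in M$ and a function $\alpha_{\mathrm{upd}}:M\times C\to M$, extended to $\widehat{\alpha}_{\mathrm{upd}}:M\times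 C^*\to M$; $L_{m,m'}=\{w\in C^*:\widehat\alpha_{\mathrm{upd}}(m,w)=m'\}$. A strategy $\sigma_i$ of player $i$ is *based on* $\mathcal M$ if there is a function $\alpha_{\mathrm{nxt}}:M\times S_i\to E$, with $\alpha_{\mathrm{nxt}}(m,s)$ leaving $s$, such that for every history $\rho$ with color word $w$ and last state $s\in S_i$, $\sigma_i(\rho)=\alpha_{\mathrm{nxt}}(\widehat\alpha_{\mathrm{upd}}(m_{\mathrm{init}},w),s)$. For a state $s$ let $c_s(\sigma_1,\sigma_2)\in C^\omega$ be the color sequence of the unique play from $s$ consistent with $\sigma_1,\sigma_2$, and let $$U_s(\sigma_1)=\{x:\exists\sigma_2,\ c_s(\sigma_1,\sigma_2)\sqsubseteq x\},\qquad D_s(\sigma_2)=\{x:\exists\sigma_1,\ x\sqsubseteq c_s(\sigma_1,\sigma_2)\}.$$ A strategy $\sigma_1$ of player 1 is *uniformly optimal* if $U_s(\sigma_1)\subseteq U_s(\sigma_1')$ for all states $s$ and all strategies $\sigma_1'$ of player 1; a strategy $\sigma_2$ of player 2 is uniformly optimal if $D_s(\sigma_2)\subseteq D_s(\sigma'_2)$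 for all $s$ and all strategies $\sigma_2'$ of player 2. Let $\mathcal R(C)$ be the set of all languages $K\subseteq C^*$ that are regular over some finite alphabet $B\subseteq C$. For $K\subseteq C^*$ let $[K]\subseteq C^\omega$ be the set of infinite words all of whose finite prefixes are prefixes of words of $K$. The relation $\sqsubseteq$ is *$\mathcal M$-monotone* if for all $m\in M$ and $K_1,K_2\in\mathcal R(C)$, $$\bigl(\exists w\in L_{m_{\mathrm{init}},m}:\ [wK_1]\sqsubset[wK_2]\bigr)\implies\bigl(\forall w'\in L_{m_{\mathrm{init}},m}:\ [w'K_1]\sqsubseteq[w'K_2]\bigr).$$ It is *$\mathcal M$-selective* if for all $w\in C^*$, with $m=\widehat\alpha_{\mathrm{upd}}(m_{\mathrm{init}},w)$, all $K_1,K_2\in\mathcal R(C)$ with $K_1,K_2\subseteq L_{m,m}$, and all $K_3\in\mathcal R(C)$, $$[w(K_1\cup K_2)^*K_3]\sqsubseteq[wK_1^*]\cup[wK_2^*]\cup[wK_3].$$ **Theorem (Equivalence).** Let $\sqsubseteq$ be a preference relation on $C^\omega$ and let $\mathcal M$ be a memory skeleton. Then both players have uniformly-optimal finite-memory strategies based on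 $\mathcal M$ in all games $(\mathcal A,\sqsubseteq)$ if and only if $\sqsubseteq$ and $\sqsubseteq^{-1}$ are both $\mathcal M$-monotone and $\mathcal M$-selective. -/

import Mathlib

universe u v w

namespace FMGames

/-! Words and languages of colors. -/

/-- The finite word `x 0, …, x (n - 1)` of the first `n` letters of an infinite sequence. -/
def take {α : Type*} (x : ℕ → α) (n : ℕ) : List α := (List.range n).map x

/-- The languages of finite words over `C` that are regular over some finite alphabet `B ⊆ C`. -/
def Rec (C : Type u) : Set (Language C) :=
  {K | ∃ (B : Finset C) (L : Language B), L.IsRegular ∧ K = Language.map Subtype.val L}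

/-- `[K]`: the infinite words all of whose finite prefixes are prefixes of words of `K`. -/
def prefClosure {C : Type u} (K : Language C) : Set (ℕ → C) :=
  {x | ∀ n, ∃ y ∈ K, take x n <+: y}

/-! Preference relations. -/

/-- A preference relation: a total preorder on infinite words. -/
structure Preference (C : Type u) where
  le : (ℕ → C) → (ℕ → C) → Prop
  refl : ∀ x, le x x
  trans : ∀ x y z, le x y → le y z → le x z
  total : ∀ x y, le x y ∨ le y x

namespace Preference

variable {C : Type u}

/-- The inverse preference relation. -/
def inverse (P : Preference C) : Preference C where
  le x y := P.le y x
  refl := P.refl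
  trans x y z hxy hyz := P.trans z y x hyz hxy
  total x y := P.total y x

/-- The strict relation on words. -/
def lt (P : Preference C) (x y : ℕ → C) : Prop := ¬ P.le y x

/-- The extension of the relation to sets of infinite words. -/
def setLE (P : Preference C) (X Y : Set (ℕ → C)) : Prop := ∀ x ∈ X, ∃ y ∈ Y, P.le x y

/-- The strict extension of the relation to sets of infinite words. -/
def setLT (P : Preference C) (X Y : Set (ℕ → C)) : Prop := ∃ y ∈ Y, ∀ x ∈ X, P.lt x y

end Preference

/-! Memory skeletons. -/

/-- A memory skeleton with set of states `M` (which the theorem takes to be finite). -/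
structure Skeleton (C : Type u) (M : Type w) where
  init : M
  upd : M → C → M

namespace Skeleton

variable {C : Type u} {M : Type w}

/-- The extension of the update function to finite words. -/
def updHat (𝓜 : Skeleton C M) (m : M) (x : List C) : M := x.foldl 𝓜.upd m

/-- `L_{m, m'}`: the finite words that are read from `m` to `m'`. -/
def lang (𝓜 : Skeleton C M) (m m' : M) : Language C := {x | 𝓜.updHat m x = m'}

end Skeleton

namespace Preference

variable {C : Type u} {M : Type w}

/-- `𝓜`-monotony. -/
def IsMonotone (P : Preference C) (𝓜 : Skeleton C M) : Prop :=
  ∀ m : M, ∀ K₁ ∈ Rec C, ∀ K₂ ∈ Rec C,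
    (∃ x ∈ 𝓜.lang 𝓜.init m, P.setLT (prefClosure ({x} * K₁)) (prefClosure ({x} * K₂))) →
      ∀ y ∈ 𝓜.lang 𝓜.init m, P.setLE (prefClosure ({y} * K₁)) (prefClosure ({y} * K₂))

/-- `𝓜`-selectivity. -/
def IsSelective (P : Preference C) (𝓜 : Skeleton C M) : Prop :=
  ∀ (x : List C) (m : M), m = 𝓜.updHat 𝓜.init x →
    ∀ K₁ ∈ Rec C, ∀ K₂ ∈ Rec C, K₁ ≤ 𝓜.lang m m → K₂ ≤ 𝓜.lang m m → ∀ K₃ ∈ Rec C,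
      P.setLE (prefClosure ({x} * KStar.kstar (K₁ + K₂) * K₃))
        (prefClosure ({x} * KStar.kstar K₁) ∪ prefClosure ({x} * KStar.kstar K₂) ∪
          prefClosure ({x} * K₃))

end Preference

/-! Arenas, histories, plays. -/

/-- The two players. -/
inductive Player where
  | one
  | two

/-- The adversary of a player. -/
def Player.opp : Player → Player
  | .one => .two
  | .two => .one

/-- Colored edges `(source, color, target)`. -/
abbrev Edge (C : Type u) (S : Type v) : Type (max u v) := S × C × S

namespace Edge

variable {C : Type u} {S : Type v}

/-- The starting state. -/
def src (e : Edge C S) : S := e.1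

/-- The color. -/
def col (e : Edge C S) : C := e.2.1

/-- The arrival state. -/
def tgt (e : Edge C S) : S := e.2.2

end Edge

/-- An arena with set of states `S` (which the theorem takes to be finite): a partition of the
states among the players, and a finite non-blocking set of colored edges. -/
structure Arena (C : Type u) (S : Type v) where
  owner : S → Player
  edges : Set (Edge C S)
  finite_edges : edges.Finite
  nonblocking : ∀ s, ∃ e ∈ edges, Edge.src e = s

namespace Arena

variable {C : Type u} {S : Type v}

/-- `A.IsHist s ρ`: the finite sequence of edges `ρ` is a history from `s`; the empty sequence
together with `s` is the empty history at `s`. -/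
def IsHist (A : Arena C S) : S → List (Edge C S) → Prop
  | _, [] => True
  | s, e :: ρ => e ∈ A.edges ∧ Edge.src e = s ∧ A.IsHist (Edge.tgt e) ρ

/-- The last state of a history `ρ` from `s`. -/
def out : S → List (Edge C S) → S
  | s, [] => s
  | _, e :: ρ => out (Edge.tgt e) ρ

/-- `A.IsPlay s π`: the infinite sequence of edges `π` is a play from `s`. -/
def IsPlay (A : Arena C S) (s : S) (π : ℕ → Edge C S) : Prop :=
  Edge.src (π 0) = s ∧ ∀ n, π n ∈ A.edges ∧ Edge.tgt (π n) = Edge.src (π (n + 1))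

/-- A strategy of player `i`: it maps each history (`s`, `ρ`) that ends in a state of player `i` to
an edge out of this state. Values at other arguments are irrelevant. -/
structure Strategy (A : Arena C S) (i : Player) where
  act : S → List (Edge C S) → Edge C S
  valid : ∀ s ρ, A.IsHist s ρ → A.owner (out s ρ) = i →
    act s ρ ∈ A.edges ∧ Edge.src (act s ρ) = out s ρ

/-- The sequence `π` from `s` follows the strategy `σ`. -/
def Strategy.Consistent {A : Arena C S} {i : Player} (σ : A.Strategy i) (s : S)
    (π : ℕ → Edge C S) : Prop :=
  ∀ n, A.owner (out s (take π n)) = i → σ.act s (take π n) = π n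

/-- The set of plays from `s` that are consistent with a strategy of player `i` and a strategy of
the adversary. -/
def plays (A : Arena C S) (s : S) {i : Player} (σ : A.Strategy i) (τ : A.Strategy i.opp) :
    Set (ℕ → Edge C S) :=
  {π | A.IsPlay s π ∧ σ.Consistent s π ∧ τ.Consistent s π}

/-- The color sequences of a set of plays. -/
def colors (X : Set (ℕ → Edge C S)) : Set (ℕ → C) := (fun π n => Edge.col (π n)) '' X

/-! Optimality. -/

/-- Upward closure of the color sequences that a strategy may produce. -/
def UCol (A : Arena C S) (P : Preference C) (s : S) {i : Player} (σ : A.Strategy i) :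
    Set (ℕ → C) :=
  {x | ∃ τ : A.Strategy i.opp, P.setLE (colors (A.plays s σ τ)) {x}}

/-- Downward closure of the color sequences that a strategy may produce. -/
def DCol (A : Arena C S) (P : Preference C) (s : S) {i : Player} (σ : A.Strategy i) :
    Set (ℕ → C) :=
  {x | ∃ τ : A.Strategy i.opp, P.setLE {x} (colors (A.plays s σ τ))}

/-- `σ` is at least as good as `σ'` from `s` for player `i`: the first player maximizes and the
second one minimizes. -/
def AtLeastAsGood (A : Arena C S) (P : Preference C) (s : S) :
    {i : Player} → A.Strategy i → A.Strategy i → Prop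
  | .one, σ, σ' => A.UCol P s σ ⊆ A.UCol P s σ'
  | .two, σ, σ' => A.DCol P s σ ⊆ A.DCol P s σ'

/-- Optimality from every state. -/
def UniformlyOptimal (A : Arena C S) (P : Preference C) {i : Player} (σ : A.Strategy i) : Prop :=
  ∀ s, ∀ σ' : A.Strategy i, A.AtLeastAsGood P s σ σ'

/-! Finite-memory strategies. -/

/-- A next-action function of player `i` on a skeleton with set of states `M`; a skeleton with a
next-action function is a Mealy machine. -/
structure NextAction (A : Arena C S) (i : Player) (M : Type w) where
  nxt : M → S → Edge C S
  valid : ∀ m s, A.owner s = i → nxt m s ∈ A.edges ∧ Edge.src (nxt m s) = s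

/-- The strategy `σ` is encoded by some Mealy machine whose skeleton is `𝓜`. -/
def Strategy.BasedOn {A : Arena C S} {i : Player} {M : Type w} (σ : A.Strategy i)
    (𝓜 : Skeleton C M) : Prop :=
  ∃ α : A.NextAction i M, ∀ s ρ, A.IsHist s ρ → A.owner (out s ρ) = i →
    σ.act s ρ = α.nxt (𝓜.updHat 𝓜.init (ρ.map Edge.col)) (out s ρ)

/-- In the game `(A, P)`, player `i` has a uniformly-optimal finite-memory strategy based on
`𝓜`. -/
def HasUFM (A : Arena C S) (P : Preference C) {M : Type w} (𝓜 : Skeleton C M) (i : Player) :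
    Prop :=
  ∃ σ : A.Strategy i, σ.BasedOn 𝓜 ∧ A.UniformlyOptimal P σ

end Arena

end FMGames

/-!
The theorem is proved by comparing color words of finite graphs: `Path` and `Run` are the finite and
infinite paths of a graph with colored edges, regular languages are the languages of paths of finite
graphs (`pathLang_regular`, `exists_trim_graph`), and by Kőnig's lemma (`exists_run`) the words of
`[K]` are the labels of the infinite runs of a trim graph for `K`. Both players are treated at once:
`P.forPlayer i` is the relation that player `i` maximizes, and `atLeastAsGood_iff` says what
optimality means in terms of it.

Necessity uses arenas controlled by one player (`exists_optimal_runs`). One or two words lead to a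
hub in the same memory state `m`; at the hub, the player enters automata of several languages, and
some of these lead back to the hub by words in `L_{m, m}`. A strategy based on the skeleton always
leaves the hub by the same edge, hence by the same automaton, and this single choice is optimal after
each of the words (`exists_best_choice`). Two languages without return give monotony, two languages
with return and a third one without give selectivity.

For sufficiency, optimal strategies based on the skeleton are memoryless optimal strategies in the
product of the arena with the skeleton, where all histories that lead from an initial state to a
state `t` have color words that lead to the same memory state. These are found by induction on the
number of edges. If player `i` has several edges at a state `t`, divide them into two parts and take
optimal strategies in both subarenas. By monotony, one part is at least as good as the other one
after every history that leads to `t`; player `i` follows the strategy of this part, and the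
adversary answers according to the part that has been chosen at the last visit of `t`. A play that
visits `t` is then a sequence of loops at `t`, each of which stays in one part, so that selectivity
bounds it by a play that stays in one part from its first visit of `t` on, and monotony by a play that stays in
the better part (`hasHalfMemorylessValue_of_parts`). The strategy of the adversary so obtained needs
memory, but when the construction is carried out for each player, the two values agree and the two
memoryless strategies can be combined (`HasHalfMemorylessValue.combine`).
-/

namespace FMGames

/-! ### Prefixes of infinite words -/

section Words

variable {α : Type*}

theorem take_zero (x : ℕ → α) : take x 0 = [] := rfl

theorem take_succ (x : ℕ → α) (n : ℕ) : take x (n + 1) = take x n ++ [x n] := by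
  simp [take, List.range_succ]

theorem take_succ' (x : ℕ → α) (n : ℕ) :
    take x (n + 1) = x 0 :: take (fun k => x (k + 1)) n := by
  simp [take, List.range_succ_eq_map, Function.comp_def]

theorem length_take (x : ℕ → α) (n : ℕ) : (take x n).length = n := by
  simp [take]

theorem take_add (x : ℕ → α) (m n : ℕ) :
    take x (m + n) = take x m ++ take (fun k => x (m + k)) n := by
  induction n with
  | zero => simp [take_zero]
  | succ n ih => rw [← add_assoc, take_succ, ih, take_succ, List.append_assoc]

theorem take_prefix {m n : ℕ} (x : ℕ → α) (h : m ≤ n) : take x m <+: take x n := by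
  obtain ⟨k, rfl⟩ := Nat.exists_eq_add_of_le h
  exact ⟨_, (take_add x m k).symm⟩

theorem map_take {β : Type*} (f : α → β) (x : ℕ → α) (n : ℕ) :
    (take x n).map f = take (fun k => f (x k)) n := by
  simp [take, Function.comp_def]

theorem take_eq_of_prefix (x : ℕ → α) {n : ℕ} {y : List α} (h : take x n <+: y) {m : ℕ}
    (hm : m ≤ n) : take x m <+: y := (take_prefix x hm).trans h

/-- It is enough to test membership in `[K]` on arbitrarily long prefixes. -/
theorem mem_prefClosure_of_add {C : Type u} {K : Language C} {x : ℕ → C} (n₀ : ℕ)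
    (h : ∀ k, ∃ y ∈ K, take x (n₀ + k) <+: y) : x ∈ prefClosure K := by
  intro n
  obtain ⟨y, hy, hp⟩ := h n
  exact ⟨y, hy, take_eq_of_prefix x hp (Nat.le_add_left n n₀)⟩

theorem prefClosure_mono {C : Type u} {K L : Language C} (h : K ≤ L) :
    prefClosure K ⊆ prefClosure L := by
  intro x hx n
  obtain ⟨y, hy, hp⟩ := hx n
  exact ⟨y, h hy, hp⟩

theorem singleton_mul_mem {C : Type u} (y z : List C) {K : Language C} (h : z ∈ K) :
    y ++ z ∈ ({y} : Language C) * K :=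
  Language.append_mem_mul (Set.mem_singleton y) h

theorem mem_singleton_mul {C : Type u} {y z : List C} {K : Language C} :
    z ∈ ({y} : Language C) * K ↔ ∃ a ∈ K, z = y ++ a := by
  rw [Language.mem_mul]
  constructor
  · rintro ⟨b, hb, a, ha, rfl⟩
    exact ⟨a, ha, by rw [show b = y from hb]⟩
  · rintro ⟨a, ha, rfl⟩
    exact ⟨y, rfl, a, ha, rfl⟩

theorem append_mem_kstar {C : Type u} {K : Language C} {a b : List C}
    (ha : a ∈ KStar.kstar K) (hb : b ∈ K) : a ++ b ∈ KStar.kstar K := by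
  have := kstar_mul_le_kstar (a := K) (Language.append_mem_mul ha hb)
  exact this

/-- An induction principle for words of `K∗`, adding one factor at the end. -/
theorem kstar_append_induction {C : Type u} {K : Language C} {p : List C → Prop} (h0 : p [])
    (h1 : ∀ a b, p a → b ∈ K → p (a ++ b)) {a : List C} (ha : a ∈ KStar.kstar K) : p a := by
  rw [Language.mem_kstar] at ha
  obtain ⟨l, rfl, hl⟩ := ha
  induction l using List.reverseRecOn with
  | nil => exact h0
  | append_singleton l b ih =>
    rw [List.flatten_concat]
    exact h1 _ _ (ih fun y hy => hl y (by simp [hy])) (hl b (by simp))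

theorem Skeleton.updHat_append {C : Type u} {M : Type w} (𝓜 : Skeleton C M) (m : M)
    (x y : List C) : 𝓜.updHat m (x ++ y) = 𝓜.updHat (𝓜.updHat m x) y := by
  simp [Skeleton.updHat]

theorem kstar_le_lang {C : Type u} {M : Type w} (𝓜 : Skeleton C M) {m : M} {K : Language C}
    (h : K ≤ 𝓜.lang m m) : KStar.kstar K ≤ 𝓜.lang m m := by
  intro a ha
  refine kstar_append_induction (p := fun a => 𝓜.updHat m a = m) rfl ?_ ha
  intro a b ha hb
  rw [Skeleton.updHat_append, ha]
  exact h hb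

end Words

/-! ### Finite graphs, their paths and infinite runs -/

section Graphs

variable {C : Type u} {Q : Type*}

/-- `Path H q x p`: the word `x` labels a path from `q` to `p` all of whose edges belong to `H`. -/
def Path (H : Set (Edge C Q)) : Q → List C → Q → Prop
  | q, [], p => q = p
  | q, a :: x, p => ∃ o, (q, a, o) ∈ H ∧ Path H o x p

theorem path_append {H : Set (Edge C Q)} {q p : Q} {x y : List C} :
    Path H q (x ++ y) p ↔ ∃ o, Path H q x o ∧ Path H o y p := by
  induction x generalizing q with
  | nil => simp [Path]
  | cons a x ih =>
    simp only [List.cons_append, Path, ih]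
    constructor
    · rintro ⟨o, h, o', h1, h2⟩
      exact ⟨o', ⟨o, h, h1⟩, h2⟩
    · rintro ⟨o', ⟨o, h, h1⟩, h2⟩
      exact ⟨o, h, o', h1, h2⟩

theorem Path.append {H : Set (Edge C Q)} {q o p : Q} {x y : List C}
    (h1 : Path H q x o) (h2 : Path H o y p) : Path H q (x ++ y) p :=
  path_append.2 ⟨o, h1, h2⟩

theorem Path.snoc {H : Set (Edge C Q)} {q o p : Q} {x : List C} {c : C}
    (h1 : Path H q x o) (h2 : (o, c, p) ∈ H) : Path H q (x ++ [c]) p :=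
  h1.append ⟨p, h2, rfl⟩

theorem Path.mono {H H' : Set (Edge C Q)} (h : H ⊆ H') {q p : Q} {x : List C}
    (hp : Path H q x p) : Path H' q x p := by
  induction x generalizing q with
  | nil => exact hp
  | cons a x ih =>
    obtain ⟨o, h1, h2⟩ := hp
    exact ⟨o, h h1, ih h2⟩

theorem Path.of_prefix {H : Set (Edge C Q)} {q p : Q} {x y : List C} (hxy : x <+: y)
    (hp : Path H q y p) : ∃ o, Path H q x o := by
  obtain ⟨z, rfl⟩ := hxy
  obtain ⟨o, h, -⟩ := path_append.1 hp
  exact ⟨o, h⟩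

/-- `Run H r x`: the states `r 0, r 1, …` form an infinite path with edges in `H` labelled
by `x`. -/
def Run (H : Set (Edge C Q)) (r : ℕ → Q) (x : ℕ → C) : Prop :=
  ∀ n, (r n, x n, r (n + 1)) ∈ H

theorem Run.path {H : Set (Edge C Q)} {r : ℕ → Q} {x : ℕ → C} (h : Run H r x) (n : ℕ) :
    Path H (r 0) (take x n) (r n) := by
  induction n with
  | zero => rfl
  | succ n ih => rw [take_succ]; exact ih.snoc (h n)

/-- One step of Kőnig's lemma. -/
theorem exists_step_of_forall_path {H : Set (Edge C Q)} (hH : H.Finite) (q : Q) (x : ℕ → C)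
    (h : ∀ n, ∃ p, Path H q (take x n) p) :
    ∃ o, (q, x 0, o) ∈ H ∧ ∀ n, ∃ p, Path H o (take (fun k => x (k + 1)) n) p := by
  by_contra! hcon
  choose! N hN using hcon
  have hfin : {o | (q, x 0, o) ∈ H}.Finite :=
    hH.preimage (f := fun o => (q, x 0, o)) (by intro a _ b _ h; simpa using h)
  obtain ⟨B, hB⟩ := (hfin.image N).bddAbove
  obtain ⟨p, hp⟩ := h (B + 1)
  rw [take_succ'] at hp
  obtain ⟨o, ho, hop⟩ := hp
  have hle : N o ≤ B := hB ⟨o, ho, rfl⟩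
  obtain ⟨p', hp'⟩ := hop.of_prefix (take_prefix _ hle)
  exact hN o ho p' hp'

/-- Kőnig's lemma: in a finite graph, an infinite word all of whose prefixes label paths from `q`
labels an infinite run from `q`. -/
theorem exists_run {H : Set (Edge C Q)} (hH : H.Finite) (q : Q) (x : ℕ → C)
    (h : ∀ n, ∃ p, Path H q (take x n) p) : ∃ r, r 0 = q ∧ Run H r x := by
  have : Nonempty Q := ⟨q⟩
  have step := fun q (x : ℕ → C) => exists_step_of_forall_path hH q x
  choose! nx h1 h2 using step
  let r : ℕ → Q := fun n => Nat.rec q (fun n p => nx p (fun k => x (n + k))) n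
  have hr : ∀ n, ∀ k, ∃ p, Path H (r n) (take (fun k => x (n + k)) k) p := by
    intro n
    induction n with
    | zero => simpa [r] using h
    | succ n ih =>
      have := h2 _ _ ih
      intro k
      obtain ⟨p, hp⟩ := this k
      refine ⟨p, ?_⟩
      convert hp using 3
      ring_nf
  exact ⟨r, rfl, fun n => h1 _ _ (hr n)⟩

/-- The words that label a path from `q` to a state of `F`. -/
def pathLang (H : Set (Edge C Q)) (q : Q) (F : Set Q) : Language C :=
  {x | ∃ p ∈ F, Path H q x p}

/-- Path languages of finite graphs with colors in `B` are regular over `B`. -/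
theorem pathLang_regular [Finite Q] (B : Finset C) {H : Set (Edge C Q)}
    (hB : ∀ e ∈ H, Edge.col e ∈ B) (q : Q) (F : Set Q) :
    ∃ L : Language B, L.IsRegular ∧ pathLang H q F = Language.map Subtype.val L := by
  classical
  have := Fintype.ofFinite Q
  let A : NFA B Q := ⟨fun p b => {o | (p, (b : C), o) ∈ H}, {q}, F⟩
  have key : ∀ (x : List B) (p o : Q), Nonempty (A.Path p o x) ↔ Path H p (x.map Subtype.val) o := by
    intro x
    induction x with
    | nil =>
      intro p o
      constructor
      · rintro ⟨⟨⟩⟩; rfl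
      · rintro ⟨⟩; exact ⟨.nil _⟩
    | cons b x ih =>
      intro p o
      constructor
      · rintro ⟨_ | ⟨t, _, _, _, _, h1, h2⟩⟩
        exact ⟨t, h1, (ih t o).1 ⟨h2⟩⟩
      · rintro ⟨t, h1, h2⟩
        obtain ⟨h3⟩ := (ih t o).2 h2
        exact ⟨.cons t _ _ _ _ h1 h3⟩
  have lift : ∀ (x : List C) (p o : Q), Path H p x o → ∃ y : List B, y.map Subtype.val = x := by
    intro x
    induction x with
    | nil => intro p o _; exact ⟨[], rfl⟩
    | cons a x ih =>
      rintro p o ⟨t, h1, h2⟩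
      obtain ⟨y, rfl⟩ := ih t o h2
      exact ⟨⟨a, hB _ h1⟩ :: y, rfl⟩
  refine ⟨A.accepts, Language.isRegular_iff.2 ⟨_, inferInstance, A.toDFA, A.toDFA_correct⟩, ?_⟩
  ext x
  constructor
  · rintro ⟨p, hp, hx⟩
    obtain ⟨y, rfl⟩ := lift x q p hx
    exact ⟨y, NFA.accepts_iff_exists_path.2 ⟨q, rfl, p, hp, (key y q p).2 hx⟩, rfl⟩
  · rintro ⟨y, hy, rfl⟩
    obtain ⟨s, hs, p, hp, h⟩ := NFA.accepts_iff_exists_path.1 hy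
    obtain rfl : s = q := hs
    exact ⟨p, hp, (key y s p).1 h⟩

/-- A regular language over a finite alphabet is the path language of a finite graph which is trim:
a state of `F` can be reached from the target of any edge. -/
theorem exists_trim_graph {K : Language C} (hK : K ∈ Rec C) :
    ∃ (Q : Type) (Δ : Set (Edge C Q)) (q₀ : Q) (F : Set Q), Finite Q ∧ Δ.Finite ∧
      K = pathLang Δ q₀ F ∧
      ∀ e ∈ Δ, ∃ x, ∃ p ∈ F, Path Δ (Edge.tgt e) x p := by
  obtain ⟨B, L, ⟨σ, _, D, rfl⟩, rfl⟩ := hK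
  let G : Set (Edge C σ) := {e | ∃ (q : σ) (b : B), e = (q, (b : C), D.step q b)}
  have hG : G.Finite := by
    refine (Set.finite_range fun qb : σ × B =>
      ((qb.1, (qb.2 : C), D.step qb.1 qb.2) : Edge C σ)).subset ?_
    rintro _ ⟨q, b, rfl⟩
    exact ⟨(q, b), rfl⟩
  have key : ∀ (x : List C) (q p : σ), Path G q x p ↔
      ∃ y : List B, y.map Subtype.val = x ∧ D.evalFrom q y = p := by
    intro x
    induction x with
    | nil =>
      intro q p
      constructor
      · rintro rfl
        exact ⟨[], rfl, rfl⟩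
      · rintro ⟨y, hy, rfl⟩
        rw [List.map_eq_nil_iff.1 hy]
        rfl
    | cons a x ih =>
      intro q p
      constructor
      · rintro ⟨o, ⟨q', b, h⟩, h2⟩
        obtain ⟨y, rfl, rfl⟩ := (ih o p).1 h2
        simp only [Prod.mk.injEq] at h
        obtain ⟨rfl, rfl, rfl⟩ := h
        exact ⟨b :: y, rfl, rfl⟩
      · rintro ⟨_ | ⟨b, y⟩, h, rfl⟩
        · simp at h
        · simp only [List.map_cons, List.cons.injEq] at h
          obtain ⟨rfl, rfl⟩ := h
          exact ⟨D.step q b, ⟨q, b, rfl⟩, (ih _ _).2 ⟨y, rfl, rfl⟩⟩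
  let Δ : Set (Edge C σ) := {e ∈ G | ∃ x, ∃ p ∈ D.accept, Path G (Edge.tgt e) x p}
  have trim : ∀ (x : List C) (q p : σ), p ∈ D.accept → Path G q x p → Path Δ q x p := by
    intro x
    induction x with
    | nil => intro q p _ h; exact h
    | cons a x ih =>
      rintro q p hp ⟨o, h1, h2⟩
      exact ⟨o, ⟨h1, x, p, hp, h2⟩, ih o p hp h2⟩
  refine ⟨σ, Δ, D.start, D.accept, inferInstance, hG.subset (Set.sep_subset _ _), ?_, ?_⟩
  · ext x
    constructor
    · rintro ⟨y, hy, rfl⟩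
      exact ⟨_, hy, trim _ _ _ hy ((key _ _ _).2 ⟨y, rfl, rfl⟩)⟩
    · rintro ⟨p, hp, h⟩
      obtain ⟨y, rfl, rfl⟩ := (key _ _ _).1 (h.mono (Set.sep_subset _ _))
      exact ⟨y, hp, rfl⟩
  · rintro e ⟨-, x, p, hp, h⟩
    exact ⟨x, p, hp, trim x _ p hp h⟩

end Graphs

/-! ### The preference of a player, and the outcomes of strategies -/

/-- The preference relation that player `i` maximizes. -/
def Preference.forPlayer {C : Type u} (P : Preference C) : Player → Preference C
  | .one => P
  | .two => P.inverse

theorem Preference.forPlayer_opp {C : Type u} (P : Preference C) (i : Player) (x y : ℕ → C) :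
    (P.forPlayer i.opp).le x y ↔ (P.forPlayer i).le y x := by
  cases i <;> rfl

theorem Player.eq_opp_iff {i j : Player} : j = i.opp ↔ j ≠ i := by
  cases i <;> cases j <;> simp [Player.opp]

namespace Arena

variable {C : Type u} {S : Type v} {A : Arena C S}

theorem out_snoc (s : S) (ρ : List (Edge C S)) (e : Edge C S) : out s (ρ ++ [e]) = Edge.tgt e := by
  induction ρ generalizing s with
  | nil => rfl
  | cons a ρ ih => exact ih _

theorem isHist_snoc {s : S} {ρ : List (Edge C S)} {e : Edge C S} :
    A.IsHist s (ρ ++ [e]) ↔ A.IsHist s ρ ∧ e ∈ A.edges ∧ Edge.src e = out s ρ := by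
  induction ρ generalizing s with
  | nil => simp [IsHist, out]
  | cons a ρ ih => simp [IsHist, out, ih, and_assoc]

theorem IsPlay.out_take {s : S} {π : ℕ → Edge C S} (h : A.IsPlay s π) (n : ℕ) :
    out s (take π n) = Edge.src (π n) := by
  cases n with
  | zero => exact h.1.symm
  | succ n => rw [take_succ, out_snoc, (h.2 n).2]

theorem IsPlay.isHist_take {s : S} {π : ℕ → Edge C S} (h : A.IsPlay s π) (n : ℕ) :
    A.IsHist s (take π n) := by
  induction n with
  | zero => trivial
  | succ n ih => rw [take_succ]; exact isHist_snoc.2 ⟨ih, (h.2 n).1, (h.out_take n).symm⟩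

/-- The sequence of colors of a play. -/
abbrev colorSeq (π : ℕ → Edge C S) : ℕ → C := fun n => Edge.col (π n)

theorem plays_nonempty (s : S) {i : Player} (σ : A.Strategy i) (τ : A.Strategy i.opp) :
    ∃ π, π ∈ A.plays s σ τ := by
  classical
  let act : List (Edge C S) → Edge C S := fun ρ =>
    if A.owner (out s ρ) = i then σ.act s ρ else τ.act s ρ
  have hact : ∀ ρ, A.IsHist s ρ → act ρ ∈ A.edges ∧ Edge.src (act ρ) = out s ρ := by
    intro ρ h
    by_cases ho : A.owner (out s ρ) = i
    · simpa [act, ho] using σ.valid s ρ h ho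
    · simpa [act, ho] using τ.valid s ρ h (Player.eq_opp_iff.2 ho)
  let hist : ℕ → List (Edge C S) := fun n => Nat.rec [] (fun _ ρ => ρ ++ [act ρ]) n
  have hsucc : ∀ n, hist (n + 1) = hist n ++ [act (hist n)] := fun n => rfl
  let π : ℕ → Edge C S := fun n => act (hist n)
  have htake : ∀ n, take π n = hist n := by
    intro n
    induction n with
    | zero => rfl
    | succ n ih => rw [take_succ, ih]
  have hh : ∀ n, A.IsHist s (hist n) := by
    intro n
    induction n with
    | zero => trivial
    | succ n ih => exact isHist_snoc.2 ⟨ih, hact _ ih⟩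
  refine ⟨π, ⟨(hact _ (hh 0)).2, fun n => ⟨(hact _ (hh n)).1, ?_⟩⟩, ?_, ?_⟩
  · rw [show Edge.src (π (n + 1)) = _ from (hact _ (hh (n + 1))).2, hsucc, out_snoc]
  · intro n hn
    rw [htake] at hn ⊢
    simp [π, act, hn]
  · intro n hn
    rw [htake] at hn ⊢
    simp [π, act, Player.eq_opp_iff.1 hn]

theorem plays_unique {s : S} {i : Player} {σ : A.Strategy i} {τ : A.Strategy i.opp}
    {π π' : ℕ → Edge C S} (h : π ∈ A.plays s σ τ) (h' : π' ∈ A.plays s σ τ) : π = π' := by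
  have step : ∀ n, take π n = take π' n → π n = π' n := by
    intro n hn
    by_cases ho : A.owner (out s (take π n)) = i
    · rw [← h.2.1 n ho, ← h'.2.1 n (hn ▸ ho), hn]
    · have ho := Player.eq_opp_iff.2 ho
      rw [← h.2.2 n ho, ← h'.2.2 n (hn ▸ ho), hn]
  have htake : ∀ n, take π n = take π' n := by
    intro n
    induction n with
    | zero => rfl
    | succ n ih => rw [take_succ, take_succ, ih, step n ih]
  exact funext fun n => step n (htake n)

/-- Comparison of strategies, the same for both players: each answer to `σ` is matched by an answer
to `σ'` that is no better for the owner of the strategies. -/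
theorem atLeastAsGood_iff (P : Preference C) (s : S) {i : Player} (σ σ' : A.Strategy i) :
    A.AtLeastAsGood P s σ σ' ↔ ∀ τ, ∃ τ', ∀ π ∈ A.plays s σ τ, ∀ π' ∈ A.plays s σ' τ',
      (P.forPlayer i).le (colorSeq π') (colorSeq π) := by
  cases i with
  | one =>
    constructor
    · intro h τ
      obtain ⟨π, hπ⟩ := plays_nonempty s σ τ
      obtain ⟨τ', hτ'⟩ := h (show colorSeq π ∈ _ from ⟨τ, by
        rintro _ ⟨π₁, h₁, rfl⟩
        exact ⟨_, rfl, plays_unique hπ h₁ ▸ P.refl _⟩⟩)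
      refine ⟨τ', fun π₁ h₁ π' h' => ?_⟩
      obtain ⟨_, rfl, hle⟩ := hτ' _ ⟨π', h', rfl⟩
      exact plays_unique hπ h₁ ▸ hle
    · rintro h x ⟨τ, hτ⟩
      obtain ⟨τ', hτ'⟩ := h τ
      refine ⟨τ', ?_⟩
      rintro _ ⟨π', h', rfl⟩
      obtain ⟨π, hπ⟩ := plays_nonempty s σ τ
      obtain ⟨_, rfl, hle⟩ := hτ _ ⟨π, hπ, rfl⟩
      exact ⟨_, rfl, P.trans _ _ _ (hτ' π hπ π' h') hle⟩
  | two =>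
    constructor
    · intro h τ
      obtain ⟨π, hπ⟩ := plays_nonempty s σ τ
      obtain ⟨τ', hτ'⟩ := h (show colorSeq π ∈ _ from ⟨τ, by
        rintro _ rfl
        exact ⟨_, ⟨π, hπ, rfl⟩, P.refl _⟩⟩)
      refine ⟨τ', fun π₁ h₁ π' h' => ?_⟩
      obtain ⟨_, ⟨π₂, h₂, rfl⟩, hle⟩ := hτ' _ rfl
      rw [plays_unique h₁ hπ, plays_unique h' h₂]
      exact hle
    · rintro h x ⟨τ, hτ⟩
      obtain ⟨τ', hτ'⟩ := h τ
      obtain ⟨_, ⟨π, hπ, rfl⟩, hle⟩ := hτ _ rfl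
      obtain ⟨π', h'⟩ := plays_nonempty s σ' τ'
      refine ⟨τ', ?_⟩
      rintro _ rfl
      exact ⟨_, ⟨π', h', rfl⟩, P.trans _ _ _ hle (hτ' π hπ π' h')⟩

/-- A choice of an outgoing edge at each state. -/
noncomputable def someEdge (A : Arena C S) (s : S) : Edge C S := (A.nonblocking s).choose

theorem someEdge_mem (A : Arena C S) (s : S) : A.someEdge s ∈ A.edges :=
  (A.nonblocking s).choose_spec.1

theorem someEdge_src (A : Arena C S) (s : S) : Edge.src (A.someEdge s) = s :=
  (A.nonblocking s).choose_spec.2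

end Arena

/-! ### Optimal memory strategies in graphs controlled by one player -/

section Necessity

variable {C : Type u} {M : Type w}

open Arena

/-- Following a fixed play: it is the outcome of some strategy in an arena without adversary. -/
theorem exists_strategy_of_isPlay {S : Type v} (A : Arena C S) {i : Player}
    {s : S} {π : ℕ → Edge C S} (h : A.IsPlay s π) :
    ∃ σ : A.Strategy i, σ.Consistent s π := by
  classical
  refine ⟨⟨fun s' ρ => if s' = s ∧ ρ = take π ρ.length then π ρ.length else A.someEdge (out s' ρ),
    ?_⟩, ?_⟩
  · intro s' ρ _ _
    split_ifs with hc
    · obtain ⟨rfl, hρ⟩ := hc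
      refine ⟨(h.2 _).1, ?_⟩
      conv_rhs => rw [hρ]
      rw [h.out_take]
    · exact ⟨A.someEdge_mem _, A.someEdge_src _⟩
  · intro n _
    simp [length_take]

/-- In a finite graph all of whose states are controlled by player `i`, a next-action function on
the skeleton yields a best run from each state from which there is an infinite run. -/
theorem exists_optimal_runs (P : Preference C) (𝓜 : Skeleton C M) (i : Player)
    (hyp : ∀ (S : Type v) [Finite S] (A : Arena C S), A.HasUFM P 𝓜 i)
    {Q : Type*} {H : Set (Edge C Q)} (hH : H.Finite) :
    ∃ nxt : M → Q → Option (Edge C Q), ∀ q, (∃ r x, r 0 = q ∧ Run H r x) →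
      ∃ r x, r 0 = q ∧ Run H r x ∧
        (∀ n, nxt (𝓜.updHat 𝓜.init (take x n)) (r n) = some (r n, x n, r (n + 1))) ∧
        ∀ r' x', r' 0 = q → Run H r' x' → (P.forPlayer i).le x' x := by
  classical
  let live : Q → Prop := fun q => ∃ r x, r 0 = q ∧ Run H r x
  have live_run : ∀ {r x}, Run H r x → ∀ n, live (r n) := fun {r x} h n =>
    ⟨fun k => r (n + k), fun k => x (n + k), rfl, fun k => h (n + k)⟩
  have hfin : {q | live q}.Finite := by
    refine (hH.image Edge.src).subset ?_
    rintro _ ⟨r, x, rfl, h⟩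
    exact ⟨_, h 0, rfl⟩
  have : Finite {q // live q} := hfin
  obtain ⟨n, ⟨e₀⟩⟩ := Finite.exists_equiv_fin {q // live q}
  let e : ULift.{v} (Fin n) ≃ {q // live q} := Equiv.ulift.trans e₀.symm
  let ι : ULift.{v} (Fin n) → Q := fun s => (e s).1
  have hι : Function.Injective ι := Subtype.val_injective.comp e.injective
  have lift : ∀ {r x}, Run H r x → ∃ s : ℕ → ULift.{v} (Fin n), ∀ n, ι (s n) = r n := by
    intro r x h
    exact ⟨fun n => e.symm ⟨r n, live_run h n⟩, fun n => by simp [ι]⟩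
  let A : Arena C (ULift.{v} (Fin n)) :=
    { owner := fun _ => i
      edges := {d | (ι d.1, d.2.1, ι d.2.2) ∈ H}
      finite_edges := hH.preimage (f := fun d : Edge C (ULift.{v} (Fin n)) =>
        ((ι d.1, d.2.1, ι d.2.2) : Edge C Q)) (by
          rintro ⟨a, c, b⟩ _ ⟨a', c', b'⟩ _ h
          simp only [Prod.mk.injEq] at h
          rw [hι h.1, h.2.1, hι h.2.2])
      nonblocking := by
        intro s
        obtain ⟨r, x, h0, h⟩ := (e s).2
        obtain ⟨s', hs'⟩ := lift h
        refine ⟨(s' 0, x 0, s' 1), ?_, hι ?_⟩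
        · show (ι (s' 0), x 0, ι (s' 1)) ∈ H
          rw [hs', hs']
          exact h 0
        · show ι (s' 0) = _
          rw [hs', h0] }
  obtain ⟨σ, ⟨α, hα⟩, hopt⟩ := hyp _ A
  have τ₀ : A.Strategy i.opp := ⟨fun s ρ => A.someEdge s, fun s ρ _ h =>
    absurd (show i = i.opp from h) (by cases i <;> simp [Player.opp])⟩
  have plays_of_consistent : ∀ {s π} {σ' : A.Strategy i} (τ : A.Strategy i.opp), A.IsPlay s π →
      σ'.Consistent s π → π ∈ A.plays s σ' τ := fun τ h h' =>
    ⟨h, h', fun n hn => absurd (show i = i.opp from hn) (by cases i <;> simp [Player.opp])⟩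
  refine ⟨fun m q => if h : live q then
    some (let d := α.nxt m (e.symm ⟨q, h⟩); (ι d.1, d.2.1, ι d.2.2)) else none, ?_⟩
  intro q hq
  obtain ⟨s, rfl⟩ : ∃ s, ι s = q := ⟨e.symm ⟨q, hq⟩, by simp [ι]⟩
  obtain ⟨π, hπ, hσ, hτ⟩ := plays_nonempty s σ τ₀
  have hrun : Run H (fun n => ι (Edge.src (π n))) (colorSeq π) := by
    intro n
    have := (hπ.2 n).1
    show (ι (Edge.src (π n)), Edge.col (π n), ι (Edge.src (π (n + 1)))) ∈ H
    rw [← (hπ.2 n).2]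
    exact this
  refine ⟨fun n => ι (Edge.src (π n)), colorSeq π, congrArg ι hπ.1, hrun, ?_, ?_⟩
  · intro n
    have h1 := hσ n rfl
    rw [hα s _ (hπ.isHist_take n) rfl, map_take, hπ.out_take] at h1
    have h2 : live (ι (Edge.src (π n))) := live_run hrun n
    have h3 : e.symm ⟨ι (Edge.src (π n)), h2⟩ = Edge.src (π n) := by
      rw [Equiv.symm_apply_eq]
    simp only [dif_pos h2, h3, h1, ← (hπ.2 n).2]
    rfl
  · intro r' x' h0 h'
    obtain ⟨s', hs'⟩ := lift h'
    have hs0 : s' 0 = s := hι (by rw [hs', h0])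
    have hplay : A.IsPlay s (fun n => (s' n, x' n, s' (n + 1))) := by
      refine ⟨hs0, fun n => ⟨?_, rfl⟩⟩
      show (ι (s' n), x' n, ι (s' (n + 1))) ∈ H
      rw [hs', hs']
      exact h' n
    obtain ⟨σ', hσ'⟩ := exists_strategy_of_isPlay A (i := i) hplay
    obtain ⟨τ', hτ'⟩ := (atLeastAsGood_iff P s σ σ').1 (hopt s σ') τ₀
    exact hτ' π ⟨hπ, hσ, hτ⟩ _ (plays_of_consistent τ' hplay hσ')

/-! ### Necessity of monotony and selectivity -/

/-- States of the hub graph: a suffix that remains to be read, the empty one being the hub, or a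
state of one of the automata. -/
abbrev HubState (C : Type u) {J : Type} (Q : J → Type) : Type u := List C ⊕ (Σ j, Q j)

/-- The state `v` of the hub graph stands for the state `q` of automaton `j`; the hub stands for all
the initial states. -/
def Enters {J : Type} {Q : J → Type} (q₀ : ∀ j, Q j) (j : J) (v : HubState C Q) (q : Q j) : Prop :=
  v = .inr ⟨j, q⟩ ∨ (v = .inl [] ∧ q = q₀ j)

/-- The hub graph: two words that lead to the hub, from which automaton `j` can be entered; if
`loop j` holds, the graph is back at the hub when automaton `j` accepts. -/
inductive HubEdge {J : Type} {Q : J → Type} (Δ : ∀ j, Set (Edge C (Q j))) (q₀ : ∀ j, Q j)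
    (F : ∀ j, Set (Q j)) (loop : J → Prop) (y z : List C) : Edge C (HubState C Q) → Prop
  | chain (a : C) (x : List C) : (a :: x <:+ y ∨ a :: x <:+ z) →
      HubEdge Δ q₀ F loop y z (.inl (a :: x), a, .inl x)
  | inside (j : J) (v : HubState C Q) (q : Q j) (c : C) (q' : Q j) : Enters q₀ j v q →
      (q, c, q') ∈ Δ j → HubEdge Δ q₀ F loop y z (v, c, .inr ⟨j, q'⟩)
  | back (j : J) (v : HubState C Q) (q : Q j) (c : C) (q' : Q j) : loop j → Enters q₀ j v q →
      (q, c, q') ∈ Δ j → q' ∈ F j → HubEdge Δ q₀ F loop y z (v, c, .inl [])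

section Hub

variable {J : Type} {Q : J → Type} {Δ : ∀ j, Set (Edge C (Q j))} {q₀ : ∀ j, Q j}
  {F : ∀ j, Set (Q j)} {loop : J → Prop} {y z : List C}

/-- The union of the languages whose words lead back to the hub. -/
def loopLang (K : J → Language C) (loop : J → Prop) : Language C := {b | ∃ j, loop j ∧ b ∈ K j}

theorem hubEdge_finite [Finite J] [∀ j, Finite (Q j)] (hΔ : ∀ j, (Δ j).Finite) :
    {e | HubEdge Δ q₀ F loop y z e}.Finite := by
  let V : Set (HubState C Q) := Sum.inl '' {x : List C | x <:+ y ∨ x <:+ z} ∪ Set.range Sum.inr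
  let B : Set C := {c | c ∈ y ∨ c ∈ z} ∪ ⋃ j, Edge.col '' Δ j
  have hV : V.Finite := by
    refine Set.Finite.union (Set.Finite.image _ ?_) (Set.finite_range _)
    refine ((y.tails ++ z.tails).finite_toSet).subset ?_
    intro x hx
    simpa using hx
  have hB : B.Finite := by
    refine Set.Finite.union ?_ (Set.finite_iUnion fun j => (hΔ j).image _)
    refine ((y ++ z).finite_toSet).subset ?_
    intro x hx
    simpa using hx
  have hub : .inl [] ∈ V := .inl ⟨[], .inl List.nil_suffix, rfl⟩
  have hE : ∀ {j v q}, Enters q₀ j v q → v ∈ V := by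
    rintro j v q (rfl | ⟨rfl, -⟩)
    · exact .inr ⟨_, rfl⟩
    · exact hub
  refine (hV.prod (hB.prod hV)).subset ?_
  rintro _ (⟨a, x, h⟩ | ⟨j, v, q, c, q', h, hd⟩ | ⟨j, v, q, c, q', -, h, hd, -⟩)
  · refine ⟨.inl ⟨_, h, rfl⟩, .inl ?_, .inl ⟨_, ?_, rfl⟩⟩
    · exact h.imp (fun h => h.subset (by simp)) (fun h => h.subset (by simp))
    · exact h.imp (List.suffix_cons a x).trans (List.suffix_cons a x).trans
  · exact ⟨hE h, .inr (Set.mem_iUnion.2 ⟨j, _, hd, rfl⟩), .inr ⟨_, rfl⟩⟩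
  · exact ⟨hE h, .inr (Set.mem_iUnion.2 ⟨j, _, hd, rfl⟩), hub⟩

theorem path_chain {x : List C} (hx : x <:+ y ∨ x <:+ z) :
    Path {e | HubEdge Δ q₀ F loop y z e} (.inl x) x (.inl []) := by
  induction x with
  | nil => rfl
  | cons a x ih =>
    exact ⟨_, .chain a x hx, ih (hx.imp (List.suffix_cons a x).trans (List.suffix_cons a x).trans)⟩

theorem path_inside {j : J} {v : HubState C Q} {q q' : Q j} {x : List C} (hv : Enters q₀ j v q)
    (hx : Path (Δ j) q x q') :
    ∃ v', Enters q₀ j v' q' ∧ Path {e | HubEdge Δ q₀ F loop y z e} v x v' := by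
  induction x generalizing v q with
  | nil =>
    obtain rfl : q = q' := hx
    exact ⟨v, hv, rfl⟩
  | cons a x ih =>
    obtain ⟨o, h1, h2⟩ := hx
    obtain ⟨v', h3, h4⟩ := ih (.inl rfl) h2
    exact ⟨v', h3, _, .inside j v q a o hv h1, h4⟩

theorem path_loop {j : J} (hj : loop j) {x : List C} (hx : x ∈ pathLang (Δ j) (q₀ j) (F j)) :
    Path {e | HubEdge Δ q₀ F loop y z e} (.inl []) x (.inl []) := by
  obtain ⟨p, hp, h⟩ := hx
  rcases List.eq_nil_or_concat' x with rfl | ⟨x, c, rfl⟩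
  · rfl
  · obtain ⟨o, h1, p', h2, rfl⟩ := path_append.1 h
    obtain ⟨v, h3, h4⟩ := path_inside (.inr ⟨rfl, rfl⟩) h1
    exact h4.snoc (.back j v o c p' hj h3 h2 hp)

/-- A word that reads `x ∈ {y, z}`, then loops at the hub, then runs some automaton labels a path of
the hub graph. -/
theorem exists_path_hub {x a : List C} (hx : x = y ∨ x = z) {j : J}
    (ha : a ∈ ({x} : Language C) *
      KStar.kstar (loopLang (fun j => pathLang (Δ j) (q₀ j) (F j)) loop) *
      pathLang (Δ j) (q₀ j) (F j)) :
    ∃ v, Path {e | HubEdge Δ q₀ F loop y z e} (.inl x) a v := by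
  rw [mul_assoc] at ha
  obtain ⟨d, hd, rfl⟩ := mem_singleton_mul.1 ha
  obtain ⟨b, hb, c, ⟨p, hp, hc⟩, rfl⟩ := Language.mem_mul.1 hd
  have h1 : Path {e | HubEdge Δ q₀ F loop y z e} (.inl x) x (.inl []) :=
    path_chain (by rcases hx with rfl | rfl <;> simp)
  have h2 : Path {e | HubEdge Δ q₀ F loop y z e} (.inl []) b (.inl []) := by
    refine kstar_append_induction (p := fun b =>
      Path {e | HubEdge Δ q₀ F loop y z e} (.inl []) b (.inl [])) rfl ?_ hb
    rintro a b ha ⟨j, hj, hb⟩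
    exact ha.append (path_loop hj hb)
  obtain ⟨v, -, h3⟩ := path_inside (loop := loop) (F := F) (y := y) (z := z) (.inr ⟨rfl, rfl⟩) hc
  exact ⟨v, h1.append (h2.append h3)⟩

/-- An edge with color `c` and target `v` simulates a transition of automaton `j` from `q`. -/
def Simulates (Δ : ∀ j, Set (Edge C (Q j))) (F : ∀ j, Set (Q j)) (loop : J → Prop) (j : J) (q : Q j)
    (c : C) (v : HubState C Q) : Prop :=
  (∃ q', v = .inr ⟨j, q'⟩ ∧ (q, c, q') ∈ Δ j) ∨
    (loop j ∧ v = .inl [] ∧ ∃ q' ∈ F j, (q, c, q') ∈ Δ j)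

theorem hubEdge_of_cons {a c : C} {x : List C} {v : HubState C Q}
    (h : HubEdge Δ q₀ F loop y z (.inl (a :: x), c, v)) : c = a ∧ v = .inl x := by
  cases h with
  | chain _ _ h => exact ⟨rfl, rfl⟩
  | inside j _ q c q' h hd => rcases h with h | ⟨h, -⟩ <;> simp at h
  | back j _ q c q' _ h hd hf => rcases h with h | ⟨h, -⟩ <;> simp at h

theorem hubEdge_of_nil {c : C} {v : HubState C Q}
    (h : HubEdge Δ q₀ F loop y z (.inl [], c, v)) : ∃ j, Simulates Δ F loop j (q₀ j) c v := by
  cases h with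
  | inside j _ q c q' h hd =>
    rcases h with h | ⟨-, rfl⟩
    · simp at h
    · exact ⟨j, .inl ⟨q', rfl, hd⟩⟩
  | back j _ q c q' hj h hd hf =>
    rcases h with h | ⟨-, rfl⟩
    · simp at h
    · exact ⟨j, .inr ⟨hj, rfl, q', hf, hd⟩⟩

theorem hubEdge_of_inr {j : J} {q : Q j} {c : C} {v : HubState C Q}
    (h : HubEdge Δ q₀ F loop y z (.inr ⟨j, q⟩, c, v)) : Simulates Δ F loop j q c v := by
  cases h with
  | inside j _ q c q' h hd =>
    rcases h with h | ⟨h, -⟩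
    · cases h
      exact .inl ⟨q', rfl, hd⟩
    · simp at h
  | back j _ q c q' hj h hd hf =>
    rcases h with h | ⟨h, -⟩
    · cases h
      exact .inr ⟨hj, rfl, q', hf, hd⟩
    · simp at h

theorem run_chain {r : ℕ → HubState C Q} {x : ℕ → C} {a : List C}
    (h : Run {e | HubEdge Δ q₀ F loop y z e} r x) (h0 : r 0 = .inl a) :
    take x a.length = a ∧ r a.length = .inl [] := by
  induction a generalizing r x with
  | nil => exact ⟨rfl, h0⟩
  | cons c a ih =>
    have h1 := h 0
    rw [h0] at h1
    obtain ⟨h2, h3⟩ := hubEdge_of_cons h1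
    obtain ⟨h4, h5⟩ := ih (r := fun k => r (k + 1)) (x := fun k => x (k + 1))
      (fun n => h (n + 1)) h3
    exact ⟨by rw [List.length_cons, take_succ', h2, h4], h5⟩

end Hub

/-- The common core of monotony and selectivity. The words `y` and `z` lead to the memory state `m`,
in which a choice has to be made between the languages `K j`; if `loop j` holds, the choice has to be
made again after each word of `K j`. As the memory state is the same each time, an optimal strategy
makes the same choice `j` forever, after `y` and after `z`. -/
theorem exists_best_choice (P : Preference C) (𝓜 : Skeleton C M) (i : Player)
    (hyp : ∀ (S : Type v) [Finite S] (A : Arena C S), A.HasUFM P 𝓜 i)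
    {J : Type} [Finite J] [Nonempty J] (K : J → Language C) (hK : ∀ j, K j ∈ Rec C)
    (loop : J → Prop) [DecidablePred loop] {m : M} (hloop : ∀ j, loop j → K j ≤ 𝓜.lang m m)
    {y z : List C} (hy : y ∈ 𝓜.lang 𝓜.init m) (hz : z ∈ 𝓜.lang 𝓜.init m) :
    ∃ j, ∀ x, x = y ∨ x = z → ∀ j', (P.forPlayer i).setLE
      (prefClosure ({x} * KStar.kstar (loopLang K loop) * K j'))
      (prefClosure ({x} * if loop j then KStar.kstar (K j) else K j)) := by
  choose Q Δ q₀ F hQ hΔ hKΔ htrim using fun j => exists_trim_graph (hK j)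
  let H : Set (Edge C (HubState C Q)) := {e | HubEdge Δ q₀ F loop y z e}
  have hH : H.Finite := hubEdge_finite hΔ
  have hrun : ∀ x, x = y ∨ x = z → ∀ j', ∀ t ∈ prefClosure
      (({x} : Language C) * KStar.kstar (loopLang K loop) * K j'),
      ∃ r, r 0 = .inl x ∧ Run H r t := by
    intro x hx j' t ht
    refine exists_run hH _ _ fun n => ?_
    obtain ⟨a, ha, hp⟩ := ht n
    rw [show K = fun j => pathLang (Δ j) (q₀ j) (F j) from funext hKΔ] at ha
    obtain ⟨v, hv⟩ := exists_path_hub hx ha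
    exact hv.of_prefix hp
  have hmem : ∀ x, x = y ∨ x = z → 𝓜.updHat 𝓜.init x = m := by
    rintro x (rfl | rfl)
    exacts [hy, hz]
  obtain ⟨nxt, hnxt⟩ := exists_optimal_runs P 𝓜 i hyp hH
  by_cases hlive : ∃ x, (x = y ∨ x = z) ∧ ∃ r t, r 0 = .inl x ∧ Run H r t
  swap
  · refine ⟨Classical.arbitrary J, fun x hx j' t ht => ?_⟩
    obtain ⟨r, h0, h⟩ := hrun x hx j' t ht
    exact absurd ⟨x, hx, r, t, h0, h⟩ hlive
  obtain ⟨x₀, hx₀, hl⟩ := hlive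
  -- The edge that is chosen at the hub in memory state `m` fixes the automaton `j`.
  obtain ⟨r₀, t₀, h0, h, hn, -⟩ := hnxt _ hl
  obtain ⟨h1, h2⟩ := run_chain h h0
  have hn := hn x₀.length
  have hedge := h x₀.length
  rw [h1, hmem x₀ hx₀, h2] at hn
  rw [h2] at hedge
  obtain ⟨j, hj⟩ := hubEdge_of_nil hedge
  refine ⟨j, fun x hx j' t ht => ?_⟩
  obtain ⟨r', h0', h'⟩ := hrun x hx j' t ht
  obtain ⟨r, s, hr0, hr, hrn, hbest⟩ := hnxt _ ⟨r', t, h0', h'⟩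
  refine ⟨s, ?_, hbest r' t h0' h'⟩
  obtain ⟨h3, h4⟩ := run_chain hr hr0
  have live_of_edge : ∀ {q c v}, Simulates Δ F loop j q c v → ∃ b, ∃ p ∈ F j, Path (Δ j) q b p := by
    rintro q c v (⟨q', -, hd⟩ | ⟨-, -, q', -, hd⟩) <;>
    · obtain ⟨b, p, hp, hb⟩ := htrim j _ hd
      exact ⟨c :: b, p, hp, q', hd, hb⟩
  -- At each time, some words of `K j` have been read, and the current one has been read up to `q`.
  have inv : ∀ k, ∃ a b q, take s (x.length + k) = x ++ (a ++ b) ∧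
      ((loop j ∧ a ∈ KStar.kstar (K j)) ∨ a = []) ∧ Path (Δ j) (q₀ j) b q ∧
      (∃ d, ∃ p ∈ F j, Path (Δ j) q d p) ∧
      (r (x.length + k) = .inr ⟨j, q⟩ ∨ (r (x.length + k) = .inl [] ∧ q = q₀ j ∧ b = [])) := by
    intro k
    induction k with
    | zero =>
      exact ⟨[], [], q₀ j, by simpa using h3, .inr rfl, rfl, live_of_edge hj, .inr ⟨h4, rfl, rfl⟩⟩
    | succ k ih =>
      obtain ⟨a, b, q, ht, ha, hb, -, hq⟩ := ih
      have hsim : Simulates Δ F loop j q (s (x.length + k)) (r (x.length + k + 1)) := by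
        rcases hq with hq | ⟨hq, rfl, rfl⟩
        · have := hr (x.length + k)
          rw [hq] at this
          exact hubEdge_of_inr this
        · have hm : 𝓜.updHat 𝓜.init (take s (x.length + k)) = m := by
            rw [ht, Skeleton.updHat_append, hmem x hx, List.append_nil]
            rcases ha with ⟨hl, ha⟩ | rfl
            · exact kstar_le_lang 𝓜 (hloop j hl) ha
            · rfl
          have := hrn (x.length + k)
          rw [hm, hq, hn] at this
          simp only [Option.some.injEq, Prod.mk.injEq, true_and] at this
          rw [← this.1, ← this.2]
          exact hj
      rw [← add_assoc, take_succ, ht]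
      rcases hsim with ⟨q', hv, hd⟩ | ⟨hl, hv, q', hf, hd⟩
      · refine ⟨a, b ++ [s (x.length + k)], q', by simp, ha, hb.snoc hd, htrim j _ hd, .inl hv⟩
      · have hin : b ++ [s (x.length + k)] ∈ K j := by
          rw [hKΔ]
          exact ⟨q', hf, hb.snoc hd⟩
        refine ⟨a ++ (b ++ [s (x.length + k)]), [], q₀ j, by simp, .inl ⟨hl, ?_⟩, rfl,
          live_of_edge hj, .inr ⟨hv, rfl, rfl⟩⟩
        rcases ha with ⟨-, ha⟩ | rfl
        · exact append_mem_kstar ha hin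
        · exact append_mem_kstar (Language.nil_mem_kstar _) hin
  refine mem_prefClosure_of_add x.length fun k => ?_
  obtain ⟨a, b, q, ht, ha, hb, ⟨d, p, hp, hd⟩, -⟩ := inv k
  have hin : b ++ d ∈ K j := by
    rw [hKΔ]
    exact ⟨p, hp, hb.append hd⟩
  refine ⟨x ++ (a ++ (b ++ d)), singleton_mul_mem _ _ ?_, ht ▸ ⟨d, by simp⟩⟩
  split_ifs with hl
  · rcases ha with ⟨-, ha⟩ | rfl
    · exact append_mem_kstar ha hin
    · exact append_mem_kstar (Language.nil_mem_kstar _) hin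
  · rcases ha with ⟨hl', -⟩ | rfl
    · exact absurd hl' hl
    · exact hin

theorem isMonotone_of_hasUFM (P : Preference C) (𝓜 : Skeleton C M) (i : Player)
    (hyp : ∀ (S : Type v) [Finite S] (A : Arena C S), A.HasUFM P 𝓜 i) :
    (P.forPlayer i).IsMonotone 𝓜 := by
  rintro m K₁ hK₁ K₂ hK₂ ⟨x, hx, t₀, ht₀, hlt⟩ y hy
  obtain ⟨j, hj⟩ := exists_best_choice P 𝓜 i hyp (fun b : Bool => if b then K₂ else K₁)
    (by intro b; cases b <;> assumption) (fun _ => False) (m := m) (by simp) hx hy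
  have emb : ∀ (a : List C) (L K : Language C), prefClosure ({a} * K) ⊆
      prefClosure ({a} * KStar.kstar L * K) := by
    intro a L K
    refine prefClosure_mono ?_
    rw [mul_assoc]
    intro b hb
    obtain ⟨c, hc, rfl⟩ := mem_singleton_mul.1 hb
    exact singleton_mul_mem _ _ (Language.append_mem_mul (Language.nil_mem_kstar _) hc)
  cases j with
  | false =>
    obtain ⟨t, ht, hle⟩ := hj x (.inl rfl) true t₀ (emb _ _ _ ht₀)
    exact absurd hle (hlt t (by simpa using ht))
  | true =>
    intro t ht
    simpa using hj y (.inr rfl) false t (emb _ _ _ ht)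

theorem isSelective_of_hasUFM (P : Preference C) (𝓜 : Skeleton C M) (i : Player)
    (hyp : ∀ (S : Type v) [Finite S] (A : Arena C S), A.HasUFM P 𝓜 i) :
    (P.forPlayer i).IsSelective 𝓜 := by
  intro x m hm K₁ hK₁ K₂ hK₂ hL₁ hL₂ K₃ hK₃
  obtain ⟨j, hj⟩ := exists_best_choice P 𝓜 i hyp
    (fun o : Option Bool => o.elim K₃ fun b => if b then K₂ else K₁)
    (by rintro (_ | _ | _) <;> assumption) (fun o => o ≠ none) (m := m)
    (by rintro (_ | _ | _) h; exacts [absurd rfl h, hL₁, hL₂]) (y := x) (z := x) hm.symm hm.symm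
  have hsum : loopLang (fun o : Option Bool => o.elim K₃ fun b => if b then K₂ else K₁)
      (fun o => o ≠ none) = K₁ + K₂ := by
    ext b
    constructor
    · rintro ⟨_ | _ | _, h, hb⟩
      exacts [absurd rfl h, .inl hb, .inr hb]
    · rintro (hb | hb)
      exacts [⟨some false, by simp, hb⟩, ⟨some true, by simp, hb⟩]
  intro t ht
  obtain ⟨s, hs, hle⟩ := hj x (.inl rfl) none t (by rw [hsum]; exact ht)
  refine ⟨s, ?_, hle⟩
  rcases j with _ | _ | _
  · exact .inr hs
  · exact .inl (.inl hs)
  · exact .inl (.inr hs)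

end Necessity

/-! ### Sufficiency: merging optimal strategies of two subarenas -/

section Sufficiency

open Arena

variable {C : Type u} {M : Type w}

theorem prefClosure_add {K L : Language C} {x : ℕ → C} (h : x ∈ prefClosure (K + L)) :
    x ∈ prefClosure K ∨ x ∈ prefClosure L := by
  by_contra! hcon
  obtain ⟨h1, h2⟩ := hcon
  simp only [prefClosure, Set.mem_ofPred_eq, not_forall, not_exists, not_and] at h1 h2
  obtain ⟨n₁, h1⟩ := h1
  obtain ⟨n₂, h2⟩ := h2
  obtain ⟨y, hy | hy, hp⟩ := h (max n₁ n₂)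
  · exact h1 y hy (take_eq_of_prefix x hp (le_max_left _ _))
  · exact h2 y hy (take_eq_of_prefix x hp (le_max_right _ _))

/-- Under monotony, one of two languages is at least as good as the other one after all words that
lead to the memory state `m`. -/
theorem Preference.IsMonotone.exists_better {P : Preference C} {𝓜 : Skeleton C M}
    (h : P.IsMonotone 𝓜) (m : M) (K : Bool → Language C) (hK : ∀ b, K b ∈ Rec C) :
    ∃ k, ∀ b, ∀ y ∈ 𝓜.lang 𝓜.init m,
      P.setLE (prefClosure ({y} * K b)) (prefClosure ({y} * K k)) := by
  have self : ∀ X : Set (ℕ → C), P.setLE X X := fun X x hx => ⟨x, hx, P.refl x⟩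
  by_cases hlt : ∃ x ∈ 𝓜.lang 𝓜.init m,
      P.setLT (prefClosure ({x} * K false)) (prefClosure ({x} * K true))
  · refine ⟨true, fun b y hy => ?_⟩
    cases b
    · exact h m _ (hK _) _ (hK _) hlt y hy
    · exact self _
  · refine ⟨false, fun b y hy => ?_⟩
    cases b
    · exact self _
    · intro x hx
      by_contra! hcon
      exact hlt ⟨y, hy, x, hx, fun z hz => hcon z hz⟩

variable {T : Type*}

/-- The states of `G` are labelled by memory states in accordance with the skeleton. -/
def IsLabelling (𝓜 : Skeleton C M) (μ : T → M) (G : Arena C T) : Prop :=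
  ∀ e ∈ G.edges, μ (Edge.tgt e) = 𝓜.upd (μ (Edge.src e)) (Edge.col e)

theorem IsLabelling.path {𝓜 : Skeleton C M} {μ : T → M} {G : Arena C T}
    (hμ : IsLabelling 𝓜 μ G) {H : Set (Edge C T)} (hH : H ⊆ G.edges) {q p : T} {x : List C}
    (h : Path H q x p) : x ∈ 𝓜.lang (μ q) (μ p) := by
  induction x generalizing q with
  | nil => obtain rfl : q = p := h; rfl
  | cons a x ih =>
    obtain ⟨o, h1, h2⟩ := h
    have h3 := ih h2
    rw [show μ o = 𝓜.upd (μ q) a from hμ _ (hH h1)] at h3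
    exact h3

/-- A choice of an edge out of each state: a memoryless strategy of each of the players. -/
def IsChoice (G : Arena C T) (f : T → Edge C T) : Prop :=
  ∀ q, f q ∈ G.edges ∧ Edge.src (f q) = q

/-- Player `i` chooses along `π` the edges that are given by `f`. -/
def Follows (G : Arena C T) (i : Player) (f : T → Edge C T) (π : ℕ → Edge C T) : Prop :=
  ∀ n, G.owner (Edge.src (π n)) = i → π n = f (Edge.src (π n))

/-- Both players have memoryless optimal strategies: from each initial state there is a value that
both of them secure. -/
def HasMemorylessValue (P : Preference C) (init : Set T) (G : Arena C T) : Prop :=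
  ∃ f, IsChoice G f ∧ ∀ s ∈ init, ∃ x, ∀ i π, G.IsPlay s π → Follows G i f π →
    (P.forPlayer i).le x (colorSeq π)

/-- There is a value from each initial state, which player `i` secures by a memoryless strategy and
the adversary secures by some strategy. -/
def HasHalfMemorylessValue (P : Preference C) (init : Set T) (G : Arena C T) (i : Player) : Prop :=
  ∃ f, IsChoice G f ∧ ∃ τ : G.Strategy i.opp, ∀ s ∈ init, ∃ x,
    (∀ π, G.IsPlay s π → Follows G i f π → (P.forPlayer i).le x (colorSeq π)) ∧
    ∀ π, G.IsPlay s π → τ.Consistent s π → (P.forPlayer i).le (colorSeq π) x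

/-- The edges out of the state `t` of player `i` are divided into two parts by `p`. If each of the
two parts yields a game with memoryless optimal strategies, then player `i` keeps a memoryless
optimal strategy when both parts are available: the one for the better part. The adversary answers
by the optimal strategy for the part that has been chosen at the last visit of `t`. -/
theorem hasHalfMemorylessValue_of_parts [Finite T] {P : Preference C} {𝓜 : Skeleton C M}
    {i : Player} (hmon : (P.forPlayer i).IsMonotone 𝓜) (hsel : (P.forPlayer i).IsSelective 𝓜)
    {μ : T → M} {G : Arena C T} (hμ : IsLabelling 𝓜 μ G) {t : T} (ht : G.owner t = i)
    (p : Edge C T → Bool) (f : Bool → T → Edge C T) (hf : ∀ b, IsChoice G (f b))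
    (hft : ∀ b, p (f b t) = b)
    (hval : ∀ b, ∀ s ∈ {s | μ s = 𝓜.init}, ∃ x, ∀ j π, G.IsPlay s π →
      (∀ n, Edge.src (π n) = t → p (π n) = b) → Follows G j (f b) π →
      (P.forPlayer j).le x (colorSeq π)) :
    HasHalfMemorylessValue P {s | μ s = 𝓜.init} G i := by
  classical
  -- The edges that remain in part `b` when the adversary follows `f b`.
  let H : Bool → Set (Edge C T) := fun b => {e ∈ G.edges | (Edge.src e = t → p e = b) ∧
    (G.owner (Edge.src e) ≠ i → e = f b (Edge.src e))}
  have hH : ∀ b, H b ⊆ G.edges := fun b => Set.sep_subset _ _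
  let K : Bool → Language C := fun b => pathLang (H b) t Set.univ
  let L : Bool → Language C := fun b => pathLang (H b) t {t}
  let B : Finset C := (G.finite_edges.image Edge.col).toFinset
  have hB : ∀ b, ∀ e ∈ H b, Edge.col e ∈ B := fun b e he =>
    (Set.Finite.mem_toFinset _).2 ⟨e, hH b he, rfl⟩
  have hreg := fun b => pathLang_regular B (hB b) t
  have hK : ∀ b, K b ∈ Rec C := fun b => ⟨B, hreg b Set.univ⟩
  have hL : ∀ b, L b ∈ Rec C := fun b => ⟨B, hreg b {t}⟩
  have hKK : K false + K true ∈ Rec C := by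
    obtain ⟨L₀, h0, e0⟩ := hreg false Set.univ
    obtain ⟨L₁, h1, e1⟩ := hreg true Set.univ
    exact ⟨B, L₀ + L₁, h0.add h1, by rw [map_add, ← e0, ← e1]⟩
  have hLK : ∀ b, KStar.kstar (L b) ≤ K b := by
    intro b a ha
    refine ⟨t, trivial, kstar_append_induction (p := fun a => Path (H b) t a t) rfl ?_ ha⟩
    rintro a c ha ⟨_, rfl, hc⟩
    exact ha.append hc
  have hLlang : ∀ b, L b ≤ 𝓜.lang (μ t) (μ t) := by
    rintro b a ⟨_, rfl, ha⟩
    exact hμ.path (hH b) ha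
  obtain ⟨k, hk⟩ := hmon.exists_better (μ t) K hK
  let mode : List (Edge C T) → Bool := List.foldl (fun b e => if Edge.src e = t then p e else b) k
  let τ : G.Strategy i.opp := ⟨fun s ρ => f (mode ρ) (out s ρ), fun s ρ _ _ => hf _ _⟩
  refine ⟨f k, hf k, τ, fun s hs => ?_⟩
  obtain ⟨x, hx⟩ := hval k s hs
  refine ⟨x, fun π hπ hfol => hx i π hπ (fun n hn => ?_) hfol, fun π hπ hτ => ?_⟩
  · rw [hfol n (hn ▸ ht), hn, hft]
  -- The adversary secures the value `x` against the plays that stay in part `k`.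
  have hrun : ∀ {r y}, r 0 = s → Run (H k) r y → (P.forPlayer i).le y x := by
    intro r y h0 h
    rw [← P.forPlayer_opp]
    refine hx i.opp (fun n => (r n, y n, r (n + 1))) ⟨h0, fun n => ⟨hH k (h n), rfl⟩⟩
      (fun n => (h n).2.1) fun n hn => (h n).2.2 (Player.eq_opp_iff.1 hn)
  let r : ℕ → T := fun n => Edge.src (π n)
  let c : ℕ → C := colorSeq π
  let md : ℕ → Bool := fun n => mode (take π n)
  have md_succ : ∀ n, md (n + 1) = if r n = t then p (π n) else md n := by
    intro n
    simp only [md, mode, take_succ, List.foldl_append, List.foldl_cons, List.foldl_nil, r]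
  have hπe : ∀ n, (r n, c n, r (n + 1)) = π n := fun n => by
    simp only [r, ← (hπ.2 n).2]
    rfl
  have hedge : ∀ n, (r n, c n, r (n + 1)) ∈ H (md (n + 1)) := by
    intro n
    rw [hπe]
    refine ⟨(hπ.2 n).1, fun hn => ?_, fun hn => ?_⟩
    · rw [md_succ, if_pos hn]
    · have hne : r n ≠ t := fun h => hn (by rw [← ht, ← h])
      have := hτ n (by rw [hπ.out_take]; exact Player.eq_opp_iff.2 hn)
      rw [md_succ, if_neg hne, ← this]
      show f (md n) (out s (take π n)) = f (md n) (Edge.src (f (md n) (out s (take π n))))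
      rw [(hf _ _).2]
  have md_const : ∀ n, (∀ j < n, r j ≠ t) → md n = k := by
    intro n
    induction n with
    | zero => intro _; rfl
    | succ n ih =>
      intro h
      rw [md_succ, if_neg (h n n.lt_succ_self), ih fun j hj => h j (hj.trans n.lt_succ_self)]
  by_cases hvisit : ∃ n, r n = t
  swap
  · push Not at hvisit
    exact hrun hπ.1 fun n => md_const (n + 1) (fun j _ => hvisit j) ▸ hedge n
  let n₀ := Nat.find hvisit
  have hn₀ : r n₀ = t := Nat.find_spec hvisit
  have hbefore : ∀ j < n₀, r j ≠ t := fun j hj => Nat.find_min hvisit hj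
  have hpath : ∀ n ≤ n₀, Path (H k) s (take c n) (r n) := by
    intro n
    induction n with
    | zero => intro _; exact hπ.1.symm
    | succ n ih =>
      intro hn
      rw [take_succ]
      refine (ih (Nat.le_of_succ_le hn)).snoc ?_
      have := hedge n
      rwa [md_const (n + 1) fun j hj => hbefore j (hj.trans_le hn)] at this
  have hpath₀ : Path (H k) s (take c n₀) t := hn₀ ▸ hpath n₀ le_rfl
  have hlang : take c n₀ ∈ 𝓜.lang 𝓜.init (μ t) := by
    have := hμ.path (hH k) hpath₀
    rwa [show μ s = 𝓜.init from hs] at this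
  -- After `n₀`, the play consists of loops at `t`, each in one of the parts, and of a last path.
  have inv : ∀ j, ∃ a ∈ KStar.kstar (L false + L true), ∃ b,
      take c (n₀ + j) = take c n₀ ++ (a ++ b) ∧ Path (H (md (n₀ + j))) t b (r (n₀ + j)) := by
    intro j
    induction j with
    | zero => exact ⟨[], Language.nil_mem_kstar _, [], by simp, hn₀.symm⟩
    | succ j ih =>
      obtain ⟨a, ha, b, h1, h2⟩ := ih
      have h3 := hedge (n₀ + j)
      rw [← add_assoc, take_succ, h1]
      by_cases hr : r (n₀ + j) = t
      · rw [hr] at h2 h3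
        have hb : b ∈ L false + L true := by
          cases hm : md (n₀ + j) <;> rw [hm] at h2
          exacts [.inl ⟨t, rfl, h2⟩, .inr ⟨t, rfl, h2⟩]
        exact ⟨a ++ b, append_mem_kstar ha hb, [c (n₀ + j)], by simp, _, h3, rfl⟩
      · have hm := md_succ (n₀ + j)
        rw [if_neg hr] at hm
        exact ⟨a, ha, b ++ [c (n₀ + j)], by simp, hm ▸ h2.snoc (hm ▸ h3)⟩
  have hcl : c ∈ prefClosure ({take c n₀} * KStar.kstar (L false + L true) *
      (K false + K true)) := by
    refine mem_prefClosure_of_add n₀ fun j => ?_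
    obtain ⟨a, ha, b, h1, h2⟩ := inv j
    refine ⟨take c n₀ ++ (a ++ b), ?_, h1 ▸ List.prefix_rfl⟩
    rw [mul_assoc]
    refine singleton_mul_mem _ _ (Language.append_mem_mul ha ?_)
    cases hm : md (n₀ + j) <;> rw [hm] at h2
    exacts [.inl ⟨_, trivial, h2⟩, .inr ⟨_, trivial, h2⟩]
  obtain ⟨y, hy, hcy⟩ := hsel (take c n₀) (μ t) hlang.symm _ (hL false) _ (hL true) (hLlang _)
    (hLlang _) _ hKK c hcl
  obtain ⟨b, hyb⟩ : ∃ b, y ∈ prefClosure ({take c n₀} * K b) := by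
    rcases hy with (hy | hy) | hy
    · exact ⟨false, prefClosure_mono (mul_le_mul_right (hLK _) _) hy⟩
    · exact ⟨true, prefClosure_mono (mul_le_mul_right (hLK _) _) hy⟩
    · rw [mul_add] at hy
      rcases prefClosure_add hy with hy | hy
      exacts [⟨_, hy⟩, ⟨_, hy⟩]
  obtain ⟨z, hz, hyz⟩ := hk b _ hlang y hyb
  obtain ⟨r', h0, h'⟩ := exists_run (G.finite_edges.subset (hH k)) s z fun n => by
    obtain ⟨d, hd, hp⟩ := hz n
    obtain ⟨d, ⟨o, -, ho⟩, rfl⟩ := mem_singleton_mul.1 hd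
    exact (hpath₀.append ho).of_prefix hp
  exact (P.forPlayer i).trans _ _ _ hcy ((P.forPlayer i).trans _ _ _ hyz (hrun h0 h'))

/-- The subarena that keeps the edges out of `t` in the part `b` only. -/
def Arena.part (G : Arena C T) (t : T) (p : Edge C T → Bool) (b : Bool)
    (h : ∃ e ∈ G.edges, Edge.src e = t ∧ p e = b) : Arena C T where
  owner := G.owner
  edges := {e ∈ G.edges | Edge.src e = t → p e = b}
  finite_edges := G.finite_edges.subset (Set.sep_subset _ _)
  nonblocking := by
    intro s
    by_cases hs : s = t
    · obtain ⟨e, he, h1, h2⟩ := h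
      exact ⟨e, ⟨he, fun _ => h2⟩, h1.trans hs.symm⟩
    · obtain ⟨e, he, h1⟩ := G.nonblocking s
      exact ⟨e, ⟨he, fun h2 => absurd (h1.symm.trans h2) hs⟩, h1⟩

/-- Player `i` has several edges to choose from at some state. -/
def HasFork (G : Arena C T) (i : Player) : Prop :=
  ∃ e ∈ G.edges, ∃ e' ∈ G.edges, G.owner (Edge.src e) = i ∧ Edge.src e' = Edge.src e ∧ e' ≠ e

theorem hasHalfMemorylessValue_of_hasFork [Finite T] {P : Preference C} {𝓜 : Skeleton C M}
    {i : Player} (hmon : (P.forPlayer i).IsMonotone 𝓜) (hsel : (P.forPlayer i).IsSelective 𝓜)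
    {μ : T → M} {G : Arena C T} (hμ : IsLabelling 𝓜 μ G) (hi : HasFork G i)
    (ih : ∀ G' : Arena C T, G'.edges.ncard < G.edges.ncard → IsLabelling 𝓜 μ G' →
      HasMemorylessValue P {s | μ s = 𝓜.init} G') :
    HasHalfMemorylessValue P {s | μ s = 𝓜.init} G i := by
  classical
  obtain ⟨e, he, e', he', ho, hsrc, hne⟩ := hi
  let p : Edge C T → Bool := fun d => decide (d = e)
  have hp : ∀ b, ∃ d ∈ G.edges, Edge.src d = Edge.src e ∧ p d = b := by
    rintro (_ | _)
    exacts [⟨e', he', hsrc, by simpa [p] using hne⟩, ⟨e, he, rfl, by simp [p]⟩]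
  have hlt : ∀ b, (G.part (Edge.src e) p b (hp b)).edges.ncard < G.edges.ncard := by
    intro b
    obtain ⟨d, hd, h1, h2⟩ := hp (!b)
    refine Set.ncard_lt_ncard ⟨Set.sep_subset _ _, fun hsub => ?_⟩ G.finite_edges
    have := (hsub hd).2 h1
    rw [h2] at this
    exact Bool.not_ne_self b this
  choose f hf hval using fun b => ih _ (hlt b) fun d hd => hμ d hd.1
  refine hasHalfMemorylessValue_of_parts hmon hsel hμ ho p f
    (fun b q => ⟨(hf b q).1.1, (hf b q).2⟩) (fun b => (hf b _).1.2 (hf b _).2) fun b s hs => ?_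
  obtain ⟨x, hx⟩ := hval b s hs
  exact ⟨x, fun j π hπ hpart hfol =>
    hx j π ⟨hπ.1, fun n => ⟨⟨(hπ.2 n).1, hpart n⟩, (hπ.2 n).2⟩⟩ hfol⟩

theorem consistent_of_not_hasFork {G : Arena C T} {i : Player} (hi : ¬ HasFork G i)
    (σ : G.Strategy i) {s : T} {π : ℕ → Edge C T} (hπ : G.IsPlay s π) : σ.Consistent s π := by
  intro n hn
  obtain ⟨h1, h2⟩ := σ.valid s _ (hπ.isHist_take n) hn
  rw [hπ.out_take] at hn h2
  by_contra hne
  exact hi ⟨_, (hπ.2 n).1, _, h1, hn, h2, hne⟩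

theorem isChoice_someEdge (G : Arena C T) : IsChoice G G.someEdge :=
  fun q => ⟨G.someEdge_mem q, G.someEdge_src q⟩

/-- The memoryless strategy given by a choice of edges. -/
def IsChoice.strategy {G : Arena C T} {f : T → Edge C T} (hf : IsChoice G f) (i : Player) :
    G.Strategy i :=
  ⟨fun s ρ => f (out s ρ), fun s ρ _ _ => hf (out s ρ)⟩

theorem HasHalfMemorylessValue.of_not_hasFork {P : Preference C} {init : Set T} {G : Arena C T}
    {i : Player} (h : HasHalfMemorylessValue P init G i) (hi : ¬ HasFork G i.opp) :
    HasMemorylessValue P init G := by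
  obtain ⟨f, hf, τ, h⟩ := h
  refine ⟨f, hf, fun s hs => ?_⟩
  obtain ⟨x, h1, h2⟩ := h s hs
  refine ⟨x, fun j π hπ hfol => ?_⟩
  by_cases hj : j = i
  · subst hj
    exact h1 π hπ hfol
  · obtain rfl := Player.eq_opp_iff.2 hj
    rw [P.forPlayer_opp]
    exact h2 π hπ (consistent_of_not_hasFork hi τ hπ)

/-- Exchangeability: the values of the two halves coincide, as the outcome of the two strategies
with memory against each other shows. -/
theorem HasHalfMemorylessValue.combine {P : Preference C} {init : Set T} {G : Arena C T}
    (h₁ : HasHalfMemorylessValue P init G .one) (h₂ : HasHalfMemorylessValue P init G .two) :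
    HasMemorylessValue P init G := by
  classical
  obtain ⟨f₁, hf₁, τ, h₁⟩ := h₁
  obtain ⟨f₂, hf₂, σ, h₂⟩ := h₂
  refine ⟨fun q => match G.owner q with | .one => f₁ q | .two => f₂ q, fun q => ?_, fun s hs => ?_⟩
  · dsimp only
    split
    exacts [hf₁ q, hf₂ q]
  obtain ⟨x₁, h11, h12⟩ := h₁ s hs
  obtain ⟨x₂, h21, h22⟩ := h₂ s hs
  obtain ⟨π, hπ, hσ, hτ⟩ := plays_nonempty (i := .one) s σ τ
  have hle : P.le x₂ x₁ := P.trans _ _ _ (h22 π hπ hσ) (h12 π hπ hτ)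
  refine ⟨x₁, fun j π hπ hfol => ?_⟩
  cases j with
  | one => exact h11 π hπ fun n hn => by simpa [hn] using hfol n hn
  | two => exact P.trans _ _ _ (h21 π hπ fun n hn => by simpa [hn] using hfol n hn) hle

/-- Memoryless optimal strategies in labelled arenas, by induction on the number of edges. -/
theorem hasMemorylessValue [Finite T] {P : Preference C} {𝓜 : Skeleton C M}
    (hmon : ∀ i, (P.forPlayer i).IsMonotone 𝓜) (hsel : ∀ i, (P.forPlayer i).IsSelective 𝓜)
    {μ : T → M} (G : Arena C T) (hμ : IsLabelling 𝓜 μ G) :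
    HasMemorylessValue P {s | μ s = 𝓜.init} G := by
  induction hn : G.edges.ncard using Nat.strong_induction_on generalizing G with
  | _ n ih =>
    have half : ∀ i, HasFork G i → HasHalfMemorylessValue P {s | μ s = 𝓜.init} G i := fun i hi =>
      hasHalfMemorylessValue_of_hasFork (hmon i) (hsel i) hμ hi
        fun G' hlt hμ' => ih _ (hn ▸ hlt) G' hμ' rfl
    by_cases c₁ : HasFork G .one <;> by_cases c₂ : HasFork G .two
    · exact (half _ c₁).combine (half _ c₂)
    · exact (half _ c₁).of_not_hasFork c₂
    · exact (half _ c₂).of_not_hasFork c₁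
    · have hf := isChoice_someEdge G
      refine HasHalfMemorylessValue.of_not_hasFork (i := .one) ⟨_, hf, hf.strategy _, ?_⟩ c₂
      intro s _
      obtain ⟨π, hπ⟩ := plays_nonempty s (hf.strategy .one) (hf.strategy .two)
      have huniq : ∀ π', G.IsPlay s π' → π' = π := fun π' h' => plays_unique
        ⟨h', consistent_of_not_hasFork c₁ _ h', consistent_of_not_hasFork c₂ _ h'⟩ hπ
      exact ⟨colorSeq π, fun π' h' _ => huniq π' h' ▸ P.refl _,
        fun π' h' _ => huniq π' h' ▸ P.refl _⟩

/-! ### Sufficiency: the product with the skeleton -/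

/-- The product of an arena with a skeleton. -/
def Arena.prod {S : Type v} [Finite M] (A : Arena C S) (𝓜 : Skeleton C M) : Arena C (S × M) where
  owner q := A.owner q.1
  edges := {e | (e.1.1, e.2.1, e.2.2.1) ∈ A.edges ∧ e.2.2.2 = 𝓜.upd e.1.2 e.2.1}
  finite_edges := by
    refine ((A.finite_edges.prod (Set.finite_univ (α := M))).image fun d =>
      (((d.1.1, d.2), d.1.2.1, (d.1.2.2, 𝓜.upd d.2 d.1.2.1)) : Edge C (S × M))).subset ?_
    rintro ⟨⟨a, m⟩, c, ⟨b, m'⟩⟩ ⟨h1, h2⟩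
    obtain rfl : m' = 𝓜.upd m c := h2
    exact ⟨((a, c, b), m), ⟨h1, trivial⟩, rfl⟩
  nonblocking := by
    rintro ⟨s, m⟩
    obtain ⟨⟨a, c, b⟩, he, rfl⟩ := A.nonblocking s
    exact ⟨((a, m), c, (b, 𝓜.upd m c)), ⟨he, rfl⟩, rfl⟩

/-- The play of the product that corresponds to a play of the arena. -/
def liftPlay {S : Type v} (𝓜 : Skeleton C M) (π : ℕ → Edge C S) : ℕ → Edge C (S × M) := fun n =>
  ((Edge.src (π n), 𝓜.updHat 𝓜.init (take (colorSeq π) n)), Edge.col (π n),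
    (Edge.src (π (n + 1)), 𝓜.updHat 𝓜.init (take (colorSeq π) (n + 1))))

theorem isPlay_liftPlay {S : Type v} [Finite M] {A : Arena C S} (𝓜 : Skeleton C M) {s : S}
    {π : ℕ → Edge C S} (h : A.IsPlay s π) : (A.prod 𝓜).IsPlay (s, 𝓜.init) (liftPlay 𝓜 π) := by
  refine ⟨Prod.ext h.1 rfl, fun n => ⟨⟨?_, ?_⟩, rfl⟩⟩
  · show (Edge.src (π n), Edge.col (π n), Edge.src (π (n + 1))) ∈ A.edges
    rw [← (h.2 n).2]
    exact (h.2 n).1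
  · show 𝓜.updHat 𝓜.init (take (colorSeq π) (n + 1)) = _
    rw [take_succ, Skeleton.updHat_append]
    rfl

/-- A memoryless strategy in the product is a next-action function on the skeleton. -/
def IsChoice.nextAction {S : Type v} [Finite M] {A : Arena C S} {𝓜 : Skeleton C M}
    {f : S × M → Edge C (S × M)} (hf : IsChoice (A.prod 𝓜) f) (i : Player) : A.NextAction i M where
  nxt m s := ((f (s, m)).1.1, (f (s, m)).2.1, (f (s, m)).2.2.1)
  valid m s _ := ⟨(hf (s, m)).1.1, congrArg Prod.fst (hf (s, m)).2⟩

theorem IsChoice.follows_liftPlay {S : Type v} [Finite M] {A : Arena C S} {𝓜 : Skeleton C M}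
    {f : S × M → Edge C (S × M)} (hf : IsChoice (A.prod 𝓜) f) {i : Player} {s : S}
    {π : ℕ → Edge C S} (hπ : A.IsPlay s π) (h : ∀ n, A.owner (Edge.src (π n)) = i →
      (hf.nextAction i).nxt (𝓜.updHat 𝓜.init (take (colorSeq π) n)) (Edge.src (π n)) = π n) :
    Follows (A.prod 𝓜) i f (liftPlay 𝓜 π) := by
  intro n hn
  have h1 := h n hn
  set m := 𝓜.updHat 𝓜.init (take (colorSeq π) n) with hm
  have h2 := hf (Edge.src (π n), m)
  show _ = f (Edge.src (π n), m)
  have hcol : (f (Edge.src (π n), m)).2.1 = Edge.col (π n) := congrArg (fun e => e.2.1) h1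
  have htgt : (f (Edge.src (π n), m)).2.2.1 = Edge.src (π (n + 1)) :=
    (congrArg (fun e => e.2.2) h1).trans (hπ.2 n).2
  have hmem : (f (Edge.src (π n), m)).2.2.2 = 𝓜.updHat 𝓜.init (take (colorSeq π) (n + 1)) := by
    rw [h2.1.2, hcol, take_succ, Skeleton.updHat_append, ← hm,
      show (f (Edge.src (π n), m)).1 = _ from h2.2]
    rfl
  exact Prod.ext h2.2.symm (Prod.ext hcol.symm (Prod.ext htgt.symm hmem.symm))

theorem hasUFM_of_isMonotone_of_isSelective [Finite M] {S : Type v} [Finite S] {P : Preference C}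
    {𝓜 : Skeleton C M} (hmon : ∀ i, (P.forPlayer i).IsMonotone 𝓜)
    (hsel : ∀ i, (P.forPlayer i).IsSelective 𝓜) (A : Arena C S) (i : Player) :
    A.HasUFM P 𝓜 i := by
  obtain ⟨f, hf, hval⟩ := hasMemorylessValue (μ := Prod.snd) hmon hsel (A.prod 𝓜)
    (by rintro e ⟨-, h⟩; exact h)
  let σ : ∀ i, A.Strategy i := fun i =>
    ⟨fun s ρ => (hf.nextAction i).nxt (𝓜.updHat 𝓜.init (ρ.map Edge.col)) (out s ρ),
      fun s ρ _ h => (hf.nextAction i).valid _ _ h⟩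
  have hfol : ∀ {i s π}, A.IsPlay s π → (σ i).Consistent s π →
      Follows (A.prod 𝓜) i f (liftPlay 𝓜 π) := by
    intro i s π hπ h
    refine hf.follows_liftPlay hπ fun n hn => ?_
    have h1 := h n ((hπ.out_take n).symm ▸ hn)
    simp only [σ, map_take, hπ.out_take] at h1
    exact h1
  refine ⟨σ i, ⟨hf.nextAction i, fun s ρ _ _ => rfl⟩, fun s σ' => ?_⟩
  obtain ⟨x, hx⟩ := hval (s, 𝓜.init) rfl
  refine (atLeastAsGood_iff P s _ _).2 fun τ => ⟨σ i.opp, fun π hπ π' hπ' => ?_⟩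
  have h1 := hx i _ (isPlay_liftPlay 𝓜 hπ.1) (hfol hπ.1 hπ.2.1)
  have h2 := hx i.opp _ (isPlay_liftPlay 𝓜 hπ'.1) (hfol hπ'.1 hπ'.2.2)
  rw [P.forPlayer_opp] at h2
  exact (P.forPlayer i).trans _ _ _ h2 h1

end Sufficiency

end FMGames

theorem theorem1 {C : Type u} {M : Type w} [Finite M]
    (P : FMGames.Preference C) (𝓜 : FMGames.Skeleton C M) :
    (∀ (S : Type v) [Finite S] (A : FMGames.Arena C S),
        A.HasUFM P 𝓜 FMGames.Player.one ∧ A.HasUFM P 𝓜 FMGames.Player.two) ↔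
      ((P.IsMonotone 𝓜 ∧ P.IsSelective 𝓜) ∧
        (P.inverse.IsMonotone 𝓜 ∧ P.inverse.IsSelective 𝓜)) := by
  constructor
  · intro h
    have h₁ : ∀ (S : Type v) [Finite S] (A : FMGames.Arena C S), A.HasUFM P 𝓜 .one :=
      fun S _ A => (h S A).1
    have h₂ : ∀ (S : Type v) [Finite S] (A : FMGames.Arena C S), A.HasUFM P 𝓜 .two :=
      fun S _ A => (h S A).2
    exact ⟨⟨FMGames.isMonotone_of_hasUFM P 𝓜 .one h₁, FMGames.isSelective_of_hasUFM P 𝓜 .one h₁⟩,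
      FMGames.isMonotone_of_hasUFM P 𝓜 .two h₂, FMGames.isSelective_of_hasUFM P 𝓜 .two h₂⟩
  · rintro ⟨⟨hm₁, hs₁⟩, hm₂, hs₂⟩ S _ A
    have hmon : ∀ i, (P.forPlayer i).IsMonotone 𝓜 := by rintro (_ | _) <;> assumption
    have hsel : ∀ i, (P.forPlayer i).IsSelective 𝓜 := by rintro (_ | _) <;> assumption
    exact ⟨FMGames.hasUFM_of_isMonotone_of_isSelective hmon hsel A .one,
      FMGames.hasUFM_of_isMonotone_of_isSelective hmon hsel A .two⟩
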